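/- **Models.** Let $G=(V,E)$ be a finite simple graph with $n$ nodes; write $N_i$ for the set of neighbours of $i$ and $N[i]=\{i\}\cup N_i$. In the R(1)W(1) model every node $i$ has a local state $x_i\in S_i$ and a set of guarded commands; a guard at $i$ is a predicate of $(x_j)_{j\in N[i]}$, and a command at $i$ rewrites $(x_j)_{j\in N[i]}$ as a function of $(x_j)_{j\in N[i]}$. A node is enabled if one of its guards is true. In a move, the central daemon selects one enabled node, which atomically executes one command whose guard is true. Executions are maximal (they stop only when no node is enabled), and the daemon is unfair (its choices are arbitrary). An algorithm $A$ stabilizes to a set $\Lambda$ of configurations in at most $T_A$ moves if $\Lambda$ is closed under moves and every maximal execution, from any configuration, reaches $\Lambda$ after at most $T_A$ moves. **Transformed algorithm.** It runs on $G$ in the synchronous, reliable message passing model; the only sending primitive is a broadcast of one message to all neighbours. Node $i$ holds $x_i$, a cache $C_i[j]$ of $x_j$ for every $j\in N_i$, a vote $r_i\in\{1,\dots,R\}$ and auxiliary variables, where $R=Kn'$ with $K\ge 2$ an integer and $n'\ge n$ a known bound on the number of nodes. A common clock runs through cycles of five rounds (phases): 1. every node broadcasts $x_i$, refreshes its caches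 and evaluates its guards on them; if some guard is true, it draws $r_i$ uniformly at random, independently of the other nodes and of the past; 2. the nodes with a true guard broadcast $r_i$; node $i$ sets $w_i$ to the node with the unique largest vote among those cast in $N[i]$ (its own included), and $w_i=\bot$ if there is none; 3. the nodes with $w_i\ne\bot$ broadcast $w_i$; a node $i$ with $w_i\neq\bot$ that receives $w_j=i$ from every neighbour $j$ executes a command with a true guard (if there is one) on $x_i$ and $C_i$; 4. the nodes that executed a command broadcast $(x_i,C_i)$; the receivers update their variable and caches with the received values; 5. the nodes whose variable was updated by a neighbour in phase 4 broadcast $x_i$; the receivers update their caches. The initial configuration is arbitrary (arbitrary values of all variables, arbitrary common phase). When several guards are true, or received values contradict each other, the choice is arbitrary, but may depend only on the past and present, not on future random draws. An execution has converged at the first start of a cycle from which on, at the start of every cycle, all caches are coherent ($C_i[j]=x_j$ for all $i$ and $j\in N_i$) and $(x_i)_{i\in V}\in\Lambda$. **Theorem.** There is an absolute constant $C$ such that the following holds for every finite graph with $n$ nodes, every R(1)W(1) algorithm $A$ on it that stabilizes in at most $T_A$ moves under the unfair central daemon, where $T_A\ge 1$, all integers $K\ge 2$ and $n'\ge n$,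 and every execution of the transformed algorithm: the expected total number of broadcasts (by all nodes) before convergence is at most $C\,n\,T_A$, and the expected number of rounds before convergence is at most $C\,T_A$. Thus the expected overhead factor of the transformation is $O(n)$ in messages and $O(1)$ in time. -/

import Mathlib

open MeasureTheory ProbabilityTheory
open scoped ENNReal

noncomputable section

section Target

variable {V : Type*}

/-- The closed neighbourhood `{i} ∪ N_i` of a node: the nodes whose variables the node `i` may read
and write in one move of the R(1)W(1) model. -/
abbrev Ball (G : SimpleGraph V) (i : V) : Type _ := {j : V // j = i ∨ G.Adj i j}

/-- The node `i` as an element of its own closed neighbourhood. -/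
def Ball.self (G : SimpleGraph V) (i : V) : Ball G i := ⟨i, Or.inl rfl⟩

/-- An assignment of values to the variables of node `i` and of its neighbours
(`S j` is the domain of the local state of node `j`). -/
abbrev View (G : SimpleGraph V) (S : V → Type*) (i : V) : Type _ := ∀ j : Ball G i, S j

/-- A distributed algorithm in the R(1)W(1) model on the network `G`: every node has a set of guarded
commands; a guard reads, and a command reads and rewrites, the local states of the node and of its
neighbours. -/
structure R1W1Algorithm (G : SimpleGraph V) (S : V → Type*) where
  Rule : V → Type*
  guard : ∀ i, Rule i → View G S i → Prop
  command : ∀ i, Rule i → View G S i → View G S i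

namespace R1W1Algorithm

variable {G : SimpleGraph V} {S : V → Type*} (A : R1W1Algorithm G S)

/-- Node `i`, seeing the values `v`, has a rule whose guard is true. -/
def Enabled (i : V) (v : View G S i) : Prop := ∃ ρ : A.Rule i, A.guard i ρ v

open scoped Classical in
/-- One move under the central daemon: exactly one enabled node atomically executes one command whose
guard is true, which rewrites the states in its closed neighbourhood. -/
def Move (γ γ' : ∀ i, S i) : Prop :=
  ∃ (i : V) (ρ : A.Rule i), A.guard i ρ (fun j => γ j) ∧
    γ' = fun k =>
      if h : k = i ∨ G.Adj i k then A.command i ρ (fun j => γ j) ⟨k, h⟩ else γ k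

/-- `e 0 → e 1 → ⋯` is a maximal execution with `L` moves (`L = ⊤`: an infinite one): it stops only
in a configuration without an enabled node. The entries of `e` beyond index `L` are irrelevant. The
daemon is unfair: no further condition is put on its choices. -/
def IsMaximalExecution (e : ℕ → ∀ i, S i) (L : ℕ∞) : Prop :=
  (∀ k : ℕ, (k : ℕ∞) < L → A.Move (e k) (e (k + 1))) ∧
    ∀ k : ℕ, (k : ℕ∞) = L → ∀ i, ¬ A.Enabled i (fun j => e k j)

/-- Under the unfair central daemon `A` is self-stabilizing with respect to the set `Λ` of legitimate
configurations, and from every configuration it converges in at most `T` moves. -/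
structure StabilizesWithin (Λ : Set (∀ i, S i)) (T : ℕ) : Prop where
  closure : ∀ γ ∈ Λ, ∀ γ', A.Move γ γ' → γ' ∈ Λ
  convergence : ∀ (e : ℕ → ∀ i, S i) (L : ℕ∞), A.IsMaximalExecution e L →
    ∃ k : ℕ, k ≤ T ∧ (k : ℕ∞) ≤ L ∧ e k ∈ Λ

end R1W1Algorithm

end Target

/-! The transformed algorithm, in the synchronous message passing model. -/

/-- The five phases of a cycle, one round each. The clock is synchronized, so that the phase is
common to all nodes. -/
inductive Phase
  | p1 | p2 | p3 | p4 | p5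

/-- A configuration of the transformed algorithm at the beginning of a round: the current phase, and
the local variables of each node `i` (votes are drawn from a set of `R` values). -/
structure MPConfig {V : Type*} (G : SimpleGraph V) (S : V → Type*) (R : ℕ) where
  phase : Phase
  /-- `mem i i` is the simulated variable `x_i`; for a neighbour `j`, `mem i j` is the cache
  `C_i[j]` of `x_j`. -/
  mem : ∀ i, View G S i
  /-- The random vote `r_i`. -/
  r : V → Fin R
  /-- `g_i`: some guard is true at `i`. -/
  g : V → Prop
  /-- `w_i`: the winner candidate elected at `i`; `none` is `⊥`. -/
  w : V → Option V
  /-- Node `i` executed a command in Phase 3. -/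
  exec : V → Prop
  /-- The variable `x_i` was updated by a neighbour in Phase 4. -/
  upd : V → Prop

namespace MPConfig

variable {V : Type*} {G : SimpleGraph V} {S : V → Type*} {R : ℕ} (c : MPConfig G S R)

/-- The simulated configuration of the target algorithm. -/
def x (i : V) : S i := c.mem i (Ball.self G i)

/-- Every cache entry equals the cached variable. -/
def Coherent : Prop := ∀ i (j : Ball G i), c.mem i j = c.x j

/-- Among the votes sent in Phase 2 by the neighbours of `i` and by `i` itself, the one sent by `v` is
the unique maximum. -/
def UniqueMax (i v : V) : Prop :=
  (v = i ∨ G.Adj i v) ∧ c.g v ∧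
    ∀ u, (u = i ∨ G.Adj i u) → c.g u → u ≠ v → c.r u < c.r v

/-- In Phase 3, node `i` has a candidate and hears from every neighbour that `i` is the winner. -/
def Wins (i : V) : Prop := c.w i ≠ none ∧ ∀ j, G.Adj i j → c.w j = some i

/-- In Phase 4, node `i` receives from its neighbour `j`, which executed a command, a message
`(x_j, C_j)` that carries the value `a` for the variable of node `k`. -/
def Receives (i k : V) (a : S k) : Prop :=
  ∃ (j : V) (h : k = j ∨ G.Adj j k), G.Adj i j ∧ c.exec j ∧ a = c.mem j ⟨k, h⟩

open scoped Classical in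
/-- The number of executions of the broadcast primitive in the round that starts in `c`. -/
def bcasts [Fintype V] : ℕ :=
  match c.phase with
  | .p1 => Fintype.card V
  | .p2 => Fintype.card {i // c.g i}
  | .p3 => Fintype.card {i // c.w i ≠ none}
  | .p4 => Fintype.card {i // c.exec i}
  | .p5 => Fintype.card {i // c.upd i}

end MPConfig

open scoped Classical in
/-- `TransformedStep A d c c'`: one round of the transformed algorithm can lead from `c` to `c'`, where
`d i` is the random number available to node `i` in this round. Nondeterminism remains in Phase 3
(which command with a true guard is executed) and in Phase 4 (which value is kept if messages disagree,
which only corrupted initial configurations can bring about). -/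
def TransformedStep {V : Type*} {G : SimpleGraph V} {S : V → Type*} {R : ℕ}
    (A : R1W1Algorithm G S) (d : V → Fin R) (c c' : MPConfig G S R) : Prop :=
  match c.phase with
  | .p1 =>
      -- broadcast `x_i`, refresh the caches, evaluate the guards, draw votes
      let mem' : ∀ i, View G S i := fun _ j => c.x j
      let g' : V → Prop := fun i => A.Enabled i (mem' i)
      c' = { c with
        phase := .p2
        mem := mem'
        g := g'
        r := fun i => if g' i then d i else c.r i }
  | .p2 =>
      -- broadcast votes, elect a winner candidate at every node
      ∃ w' : V → Option V, (∀ i v, w' i = some v ↔ c.UniqueMax i v) ∧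
        c' = { c with phase := .p3, w := w' }
  | .p3 =>
      -- broadcast the candidates; a winner executes a command on `x_i` and `C_i`
      ∃ mem' : ∀ i, View G S i,
        (∀ i, if c.Wins i ∧ A.Enabled i (c.mem i) then
            ∃ ρ : A.Rule i, A.guard i ρ (c.mem i) ∧ mem' i = A.command i ρ (c.mem i)
          else mem' i = c.mem i) ∧
        c' = { c with
          phase := .p4
          mem := mem'
          exec := fun i => c.Wins i ∧ A.Enabled i (c.mem i) }
  | .p4 =>
      -- nodes that executed a command broadcast `x_i, C_i`; receivers update `x_i` and `C_i`
      ∃ mem' : ∀ i, View G S i,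
        (∀ i (k : Ball G i),
          if ∃ a, c.Receives i k a then c.Receives i k (mem' i k) else mem' i k = c.mem i k) ∧
        c' = { c with
          phase := .p5
          mem := mem'
          upd := fun i => ∃ j, G.Adj i j ∧ c.exec j }
  | .p5 =>
      -- nodes updated in Phase 4 broadcast `x_i`; receivers update their caches
      c' = { c with
        phase := .p1
        mem := fun i k => if G.Adj i k ∧ c.upd k then c.x k else c.mem i k }

/-- `X` is a random execution of the transformed algorithm, from an arbitrary initial configuration
(with arbitrary variables, in an arbitrary phase). The numbers drawn in a round are independent and
uniform over the nodes, and independent of the past `ℱ t`; the nondeterminism left by `TransformedStep`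
is resolved in an arbitrary way. -/
structure IsTransformedExecution {V : Type*} {G : SimpleGraph V} {S : V → Type*} {R : ℕ}
    (A : R1W1Algorithm G S) {Ω : Type*} [mΩ : MeasurableSpace Ω] (μ : Measure Ω)
    (ℱ : Filtration ℕ mΩ) (d : ℕ → Ω → V → Fin R) (X : ℕ → Ω → MPConfig G S R) : Prop where
  adapted : ∀ (t : ℕ) (s : Set (MPConfig G S R)), MeasurableSet[ℱ t] (X t ⁻¹' s)
  measurable_draw : ∀ t, Measurable (d t)
  uniform_draw : ∀ t, μ.map (d t) = uniformOn Set.univ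
  indep_draw : ∀ t, Indep (ℱ t) (MeasurableSpace.comap (d t) inferInstance) μ
  step : ∀ t ω, TransformedStep A (d t ω) (X t ω) (X (t + 1) ω)

section Convergence

variable {V : Type*} {G : SimpleGraph V} {S : V → Type*} {R : ℕ}

/-- The trajectory `c` has converged by round `t`: a cycle starts at `t`, and from `t` on the caches are
coherent and the simulated configuration is legitimate at the start of every cycle. -/
def ConvergedAt (Λ : Set (∀ i, S i)) (c : ℕ → MPConfig G S R) (t : ℕ) : Prop :=
  (c t).phase = .p1 ∧ ∀ s, t ≤ s → (c s).phase = .p1 → (c s).Coherent ∧ (c s).x ∈ Λ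

/-- The number of rounds before convergence (`⊤` if the trajectory never converges). -/
def convergenceTime (Λ : Set (∀ i, S i)) (c : ℕ → MPConfig G S R) : ℕ∞ :=
  ⨅ (t : ℕ) (_ : ConvergedAt Λ c t), (t : ℕ∞)

open scoped Classical in
/-- The total number of broadcasts, by all nodes and in all rounds before convergence. -/
def bcastsBeforeConvergence [Fintype V] (Λ : Set (∀ i, S i)) (c : ℕ → MPConfig G S R) : ℝ≥0∞ :=
  ∑' t : ℕ, if (t : ℕ∞) < convergenceTime Λ c then ((c t).bcasts : ℝ≥0∞) else 0

end Convergence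

end

/-! A winner is the unique vote maximum at every node of its closed neighbourhood, so two winners
have disjoint closed neighbourhoods. Their simultaneous commands therefore amount to that many
consecutive moves of `A`, and a full cycle also makes all caches coherent, whatever it started from
(`TransformedStep.cycle`). Progress is measured by a coarse event: one enabled node outvotes all
other enabled nodes of the graph. With `R ≥ 2n` votes this has probability at least 1/2, and it
forces at least one move. Along any trajectory at most `T` cycles can both start outside `Λ` and
have a top vote, because `T` moves always lead into `Λ` (`tsum_hasTopVote_le`). Votes are
independent of the past, so each cycle start outside `Λ` is at most twice as likely as the same
event with a top vote (`measure_pending_le`). Summing over time, the expected number of cycles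
starting outside `Λ` is at most `2T`; linearity of expectation suffices, however the nondeterminism
is resolved. Each such cycle costs five rounds, and each round at most `n` broadcasts. -/

/-! ### Sequences of moves of the target algorithm. -/

namespace R1W1Algorithm

variable {V : Type*} {G : SimpleGraph V} {S : V → Type*} (A : R1W1Algorithm G S)

/-- `γ'` is reached from `γ` by exactly `m` moves. -/
def MovesIn : ℕ → (∀ i, S i) → (∀ i, S i) → Prop
  | 0, γ, γ' => γ = γ'
  | m + 1, γ, γ' => ∃ γ'', A.Move γ γ'' ∧ MovesIn m γ'' γ'

variable {A}

theorem MovesIn.trans {m k : ℕ} {γ γ' γ'' : ∀ i, S i} (h : A.MovesIn m γ γ')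
    (h' : A.MovesIn k γ' γ'') : A.MovesIn (m + k) γ γ'' := by
  induction m generalizing γ with
  | zero => cases h; simpa using h'
  | succ m ih =>
    obtain ⟨δ, h1, h2⟩ := h
    rw [Nat.succ_add_eq_add_succ, Nat.add_succ]
    exact ⟨δ, h1, ih h2⟩

theorem exists_move {γ : ∀ i, S i} {i : V} (h : A.Enabled i (fun j => γ j)) :
    ∃ γ', A.Move γ γ' := by
  obtain ⟨ρ, hρ⟩ := h
  exact ⟨_, i, ρ, hρ, rfl⟩

theorem exists_isMaximalExecution (A : R1W1Algorithm G S) (γ : ∀ i, S i) :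
    ∃ e L, A.IsMaximalExecution e L ∧ e 0 = γ := by
  classical
  let next : (∀ i, S i) → (∀ i, S i) := fun γ =>
    if h : ∃ γ', A.Move γ γ' then h.choose else γ
  have hnext : ∀ γ, (∃ γ', A.Move γ γ') → A.Move γ (next γ) := by
    intro γ h
    simp only [next, dif_pos h]
    exact h.choose_spec
  by_cases hd : ∃ k : ℕ, ¬ ∃ γ', A.Move (next^[k] γ) γ'
  · refine ⟨fun k => next^[k] γ, (Nat.find hd : ℕ), ⟨?_, ?_⟩, rfl⟩
    · intro k hk
      simp only [Function.iterate_succ_apply']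
      exact hnext _ (not_not.1 (Nat.find_min hd (by exact_mod_cast hk)))
    · intro k hk i hi
      have : k = Nat.find hd := by exact_mod_cast hk
      subst this
      exact Nat.find_spec hd (exists_move hi)
  · push Not at hd
    refine ⟨fun k => next^[k] γ, ⊤, ⟨?_, ?_⟩, rfl⟩
    · intro k _
      simp only [Function.iterate_succ_apply']
      exact hnext _ (hd k)
    · intro k hk
      exact absurd hk (ENat.natCast_ne_top k)

/-- Stabilization speaks of maximal executions only; this makes it applicable to finite sequences of
moves. -/
theorem MovesIn.exists_isMaximalExecution {m : ℕ} {γ γ' : ∀ i, S i} (h : A.MovesIn m γ γ') :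
    ∃ e L, A.IsMaximalExecution e L ∧ e 0 = γ ∧ e m = γ' ∧ (m : ℕ∞) ≤ L := by
  induction m generalizing γ with
  | zero =>
    cases h
    obtain ⟨e, L, he, h0⟩ := R1W1Algorithm.exists_isMaximalExecution A γ'
    exact ⟨e, L, he, h0, h0, by simp⟩
  | succ m ih =>
    obtain ⟨δ, h1, h2⟩ := h
    obtain ⟨e, L, he, h0, hm, hL⟩ := ih h2
    refine ⟨fun k => k.casesOn γ e, L + 1, ⟨?_, ?_⟩, rfl, hm, ?_⟩
    · rintro (_ | k) hk
      · simpa [h0] using h1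
      · refine he.1 k ?_
        push_cast at hk
        exact (ENat.add_lt_add_iff_right (by simp)).1 hk
    · rintro (_ | k) hk
      · exact absurd hk.symm (by simp)
      · refine he.2 k ?_
        push_cast at hk
        exact (ENat.add_left_injective_of_ne_top (by simp)) hk
    · push_cast
      gcongr

namespace StabilizesWithin

variable {Λ : Set (∀ i, S i)} {T : ℕ}

theorem mem_of_movesIn (hA : A.StabilizesWithin Λ T) {m : ℕ} {γ γ' : ∀ i, S i}
    (h : A.MovesIn m γ γ') (hγ : γ ∈ Λ) : γ' ∈ Λ := by
  induction m generalizing γ with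
  | zero => cases h; exact hγ
  | succ m ih =>
    obtain ⟨δ, h1, h2⟩ := h
    exact ih h2 (hA.closure _ hγ _ h1)

/-- Any maximal extension of the sequence meets `Λ` by index `T`, and closure keeps it there up to
index `m`. -/
theorem mem_of_le (hA : A.StabilizesWithin Λ T) {m : ℕ} {γ γ' : ∀ i, S i}
    (h : A.MovesIn m γ γ') (hm : T ≤ m) : γ' ∈ Λ := by
  obtain ⟨e, L, he, -, rfl, hL⟩ := h.exists_isMaximalExecution
  obtain ⟨k, hkT, -, hk⟩ := hA.convergence e L he
  have : ∀ j, k ≤ j → j ≤ m → e j ∈ Λ := by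
    intro j hj
    induction j, hj using Nat.le_induction with
    | base => exact fun _ => hk
    | succ j _ ih =>
      intro hjm
      refine hA.closure _ (ih (by omega)) _ (he.1 j (lt_of_lt_of_le ?_ hL))
      exact_mod_cast hjm
  exact this m (hkT.trans hm) le_rfl

theorem exists_enabled (hA : A.StabilizesWithin Λ T) {γ : ∀ i, S i} (h : γ ∉ Λ) :
    ∃ i, A.Enabled i (fun j => γ j) := by
  by_contra hd
  push Not at hd
  -- A configuration without enabled nodes is a maximal execution with no moves, so it must already
  -- lie in `Λ`.
  obtain ⟨k, -, hk, hm⟩ := hA.convergence (fun _ => γ) 0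
    ⟨fun k hk => absurd hk (by simp), fun _ _ => hd⟩
  exact h hm

end StabilizesWithin

/-- Simultaneous commands of nodes with pairwise disjoint closed neighbourhoods can be executed one
after the other. -/
theorem movesIn_of_disjoint {γ γ' : ∀ i, S i} (W : Finset V)
    (hdisj : ∀ i ∈ W, ∀ j ∈ W, ∀ k, (k = i ∨ G.Adj i k) → (k = j ∨ G.Adj j k) → i = j)
    (hin : ∀ i ∈ W, ∃ ρ : A.Rule i, A.guard i ρ (fun j => γ j) ∧
      ∀ k : Ball G i, γ' k = A.command i ρ (fun j => γ j) k)
    (hout : ∀ k, (∀ i ∈ W, ¬ (k = i ∨ G.Adj i k)) → γ' k = γ k) :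
    A.MovesIn W.card γ γ' := by
  classical
  induction W using Finset.induction_on generalizing γ with
  | empty =>
    show γ = γ'
    funext k
    exact (hout k (by simp)).symm
  | insert a W ha ih =>
    obtain ⟨ρ, hg, hc⟩ := hin a (Finset.mem_insert_self a W)
    rw [Finset.card_insert_of_notMem ha]
    let γ₁ : ∀ i, S i := fun k =>
      if h : k = a ∨ G.Adj a k then A.command a ρ (fun j => γ j) ⟨k, h⟩ else γ k
    -- The move of `a` writes nothing that the other nodes of `W` read, so their guards and commands
    -- are unaffected.
    have hview : ∀ i ∈ W, (fun j : Ball G i => γ₁ j) = fun j : Ball G i => γ j := by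
      intro i hi
      funext j
      refine dif_neg fun h => ha ?_
      rw [hdisj a (Finset.mem_insert_self a W) i (Finset.mem_insert_of_mem hi) j h j.2]
      exact hi
    refine ⟨γ₁, ⟨a, ρ, hg, rfl⟩, ih ?_ ?_ ?_⟩
    · exact fun i hi j hj =>
        hdisj i (Finset.mem_insert_of_mem hi) j (Finset.mem_insert_of_mem hj)
    · intro i hi
      rw [hview i hi]
      exact hin i (Finset.mem_insert_of_mem hi)
    · intro k hk
      by_cases h : k = a ∨ G.Adj a k
      · simp only [γ₁, dif_pos h]
        exact hc ⟨k, h⟩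
      · simp only [γ₁, dif_neg h]
        refine hout k fun i hi => ?_
        rcases Finset.mem_insert.1 hi with rfl | hi
        · exact h
        · exact hk i hi

end R1W1Algorithm

/-! ### Simulation of moves by one cycle. -/

section Cycle

variable {V : Type*} {G : SimpleGraph V} {S : V → Type*} {R : ℕ} {A : R1W1Algorithm G S}

/-- The phase that follows a phase. -/
def Phase.next : Phase → Phase
  | .p1 => .p2
  | .p2 => .p3
  | .p3 => .p4
  | .p4 => .p5
  | .p5 => .p1

theorem TransformedStep.phase_eq {d : V → Fin R} {c c' : MPConfig G S R}
    (h : TransformedStep A d c c') : c'.phase = c.phase.next := by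
  unfold TransformedStep at h
  split at h
  all_goals rename_i hp; rw [hp]
  · rw [h]; rfl
  · obtain ⟨_, _, rfl⟩ := h; rfl
  · obtain ⟨_, _, rfl⟩ := h; rfl
  · obtain ⟨_, _, rfl⟩ := h; rfl
  · rw [h]; rfl

/-- The vote of one enabled node exceeds the votes of all other enabled nodes. -/
def HasTopVote (E : V → Prop) (d : V → Fin R) : Prop :=
  ∃ a, E a ∧ ∀ u, E u → u ≠ a → d u < d a

theorem MPConfig.UniqueMax.unique {c : MPConfig G S R} {k i j : V} (hi : c.UniqueMax k i)
    (hj : c.UniqueMax k j) : i = j := by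
  by_contra hne
  exact lt_asymm (hi.2.2 j hj.1 hj.2.1 (Ne.symm hne)) (hj.2.2 i hi.1 hi.2.1 hne)

/-- The point is the winner itself, whose candidate is only known to differ from `⊥`. Were it a
neighbour `v`, then `v`, which elected the winner, would rank the two votes in the opposite order.
-/
theorem MPConfig.Wins.uniqueMax {c c' : MPConfig G S R}
    (hw : ∀ i v, c'.w i = some v ↔ c.UniqueMax i v) {i : V} (h : c'.Wins i) {j : V}
    (hj : j = i ∨ G.Adj i j) : c.UniqueMax j i := by
  have hadj : ∀ j, G.Adj i j → c.UniqueMax j i := fun j hj => (hw j i).1 (h.2 j hj)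
  rcases hj with rfl | hj
  · obtain ⟨v, hv⟩ := Option.ne_none_iff_exists'.1 h.1
    have hv' := (hw j v).1 hv
    rcases hv'.1 with rfl | hjv
    · exact hv'
    · have h1 := hadj v hjv
      have hne : v ≠ j := hjv.ne'
      exact absurd (hv'.2.2 j (Or.inl rfl) h1.2.1 hne.symm)
        (lt_asymm (h1.2.2 v (Or.inl rfl) hv'.2.1 hne))
  · exact hadj j hj

/-- A cycle of five rounds establishes coherence and simulates moves of the target algorithm, at
least one if some node has the top vote. -/
theorem TransformedStep.cycle [Fintype V] {d : ℕ → V → Fin R} {c : ℕ → MPConfig G S R}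
    (h : ∀ t, TransformedStep A (d t) (c t) (c (t + 1))) {t : ℕ} (hp : (c t).phase = .p1) :
    (c (t + 5)).Coherent ∧ ∃ m, A.MovesIn m (c t).x (c (t + 5)).x ∧
      (HasTopVote (fun i => A.Enabled i (fun j => (c t).x j)) (d t) → 1 ≤ m) := by
  classical
  have s1 := h t
  have s2 := h (t + 1)
  have s3 := h (t + 2)
  have s4 := h (t + 3)
  have s5 := h (t + 4)
  have p2 : (c (t + 1)).phase = .p2 := by rw [s1.phase_eq, hp]; rfl
  have p3 : (c (t + 2)).phase = .p3 := by rw [s2.phase_eq, p2]; rfl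
  have p4 : (c (t + 3)).phase = .p4 := by rw [s3.phase_eq, p3]; rfl
  have p5 : (c (t + 4)).phase = .p5 := by rw [s4.phase_eq, p4]; rfl
  simp only [TransformedStep, hp, p2, p3, p4, p5, add_assoc, Nat.reduceAdd] at s1 s2 s3 s4 s5
  generalize c (t + 5) = c5 at *
  generalize c (t + 4) = c4 at *
  generalize c (t + 3) = c3 at *
  generalize c (t + 2) = c2 at *
  generalize c (t + 1) = c1 at *
  generalize c t = c0 at *
  generalize d t = d0 at *
  clear h
  obtain ⟨w2, hw, e2⟩ := s2
  obtain ⟨m3, hm3, e3⟩ := s3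
  obtain ⟨m4, hm4, e4⟩ := s4
  have hw' : ∀ i v, c2.w i = some v ↔ c1.UniqueMax i v := by rw [e2]; exact hw
  have mem1 : ∀ i, c1.mem i = fun j : Ball G i => c0.x j := by rw [s1]; exact fun _ => rfl
  have g1 : ∀ i, c1.g i ↔ A.Enabled i (fun j => c0.x j) := by rw [s1]; exact fun _ => Iff.rfl
  have mem2 : ∀ i, c2.mem i = fun j : Ball G i => c0.x j := by rw [e2]; exact mem1
  have exec3 : ∀ i, c3.exec i ↔ c2.Wins i := by
    intro i
    rw [e3]
    refine ⟨And.left, fun hi => ⟨hi, ?_⟩⟩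
    rw [mem2]
    exact (g1 i).1 (hi.uniqueMax hw' (Or.inl rfl)).2.1
  -- A common node `k` would have both `i` and `j` as its unique maximum.
  have hdisj : ∀ {i j k}, c3.exec i → c3.exec j → (k = i ∨ G.Adj i k) → (k = j ∨ G.Adj j k) →
      i = j := fun hi hj hki hkj =>
    (((exec3 _).1 hi).uniqueMax hw' hki).unique (((exec3 _).1 hj).uniqueMax hw' hkj)
  have mem3 : ∀ i, c3.exec i → ∃ ρ : A.Rule i, A.guard i ρ (fun j => c0.x j) ∧
      c3.mem i = A.command i ρ (fun j => c0.x j) := by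
    intro i hi
    rw [e3] at hi
    have := hm3 i
    rw [if_pos hi, mem2 i] at this
    rw [e3]
    exact this
  have mem3' : ∀ i, ¬ c3.exec i → c3.mem i = fun j : Ball G i => c0.x j := by
    intro i hi
    rw [e3] at hi
    have := hm3 i
    rw [if_neg hi, mem2 i] at this
    rw [e3]
    exact this
  have mem4 : ∀ i (k : Ball G i), if ∃ a, c3.Receives i k a then c3.Receives i k (c4.mem i k)
      else c4.mem i k = c3.mem i k := by rw [e4]; exact hm4
  have upd4 : ∀ i, c4.upd i ↔ ∃ j, G.Adj i j ∧ c3.exec j := by rw [e4]; exact fun _ => Iff.rfl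
  have mem5 : ∀ i k, c5.mem i k = if G.Adj i k ∧ c4.upd k then c4.x k else c4.mem i k := by
    rw [s5]; exact fun _ _ => rfl
  have x5 : ∀ i, c5.x i = c4.x i := fun i => (mem5 i _).trans (if_neg fun h => G.irrefl h.1)
  -- inside the closed neighbourhood of a node that executed a command
  have inside : ∀ {i u} (k : Ball G u) (hk : k.1 = i ∨ G.Adj i k.1), c3.exec i →
      (u = i ∨ G.Adj i u) → c4.mem u k = c3.mem i ⟨k, hk⟩ := by
    intro i u k hk hi hu
    have := mem4 u k
    rcases hu with rfl | hu
    -- The executing node gets no message in Phase 4: its sender would be a second winner with this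
    -- node in its neighbourhood. In the other case, the same argument leaves `i` as the only
    -- sender.
    · rwa [if_neg] at this
      rintro ⟨a, j, hj, huj, hej, -⟩
      exact huj.ne (hdisj hi hej (Or.inl rfl) (Or.inr huj.symm))
    · rw [if_pos ⟨_, i, hk, hu.symm, hi, rfl⟩] at this
      obtain ⟨j, hj, huj, hej, e⟩ := this
      obtain rfl := hdisj hi hej (Or.inr hu) (Or.inr huj.symm)
      exact e
  -- outside of these neighbourhoods
  have outside : ∀ {u} (k : Ball G u), (∀ i, c3.exec i → ¬ (k.1 = i ∨ G.Adj i k.1)) →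
      c4.mem u k = c0.x k := by
    intro u k hk
    have := mem4 u k
    rw [if_neg (by rintro ⟨a, j, hj, -, hej, -⟩; exact hk j hej hj),
      mem3' u fun hu => hk u hu k.2] at this
    exact this
  refine ⟨?_, (Finset.univ.filter c3.exec).card, ?_, ?_⟩
  · intro u k
    rw [x5, mem5]
    split_ifs with hk
    · rfl
    · obtain ⟨k, hku⟩ := k
      rcases hku with rfl | hku
      · rfl
      -- Without a Phase 5 refresh, `k` has no executing neighbour: either `k` executed itself and
      -- sent its value to `u`, or nobody wrote `x_k`.
      have hupd : ¬ c4.upd k := fun h => hk ⟨hku, h⟩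
      rw [upd4] at hupd
      by_cases hek : c3.exec k
      · exact (inside ⟨k, Or.inr hku⟩ (Or.inl rfl) hek (Or.inr hku.symm)).trans
          (inside (Ball.self G k) (Or.inl rfl) hek (Or.inl rfl)).symm
      · have ho : ∀ i, c3.exec i → ¬ (k = i ∨ G.Adj i k) := by
          rintro i hi (rfl | hik)
          · exact hek hi
          · exact hupd ⟨i, hik.symm, hi⟩
        exact (outside ⟨k, Or.inr hku⟩ ho).trans (outside (Ball.self G k) ho).symm
  · refine R1W1Algorithm.movesIn_of_disjoint _ ?_ ?_ ?_
    · simp only [Finset.mem_filter, Finset.mem_univ, true_and]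
      exact fun i hi j hj k => hdisj hi hj
    · simp only [Finset.mem_filter, Finset.mem_univ, true_and]
      intro i hi
      obtain ⟨ρ, hg, hc⟩ := mem3 i hi
      refine ⟨ρ, hg, fun k => ?_⟩
      rw [x5, ← hc]
      exact inside (Ball.self G k) k.2 hi k.2
    · simp only [Finset.mem_filter, Finset.mem_univ, true_and]
      intro k hk
      rw [x5]
      exact outside (Ball.self G k) hk
  · rintro ⟨a, ha, hmax⟩
    refine Finset.card_pos.2 ⟨a, Finset.mem_filter.2 ⟨Finset.mem_univ a, (exec3 a).2 ?_⟩⟩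
    have r1 : ∀ i, c1.g i → c1.r i = d0 i := by
      intro i hi
      rw [s1]
      exact if_pos ((g1 i).1 hi)
    have hU : ∀ j, (a = j ∨ G.Adj j a) → c2.w j = some a := by
      intro j hj
      refine (hw' j a).2 ⟨hj, (g1 a).2 ha, fun u _ hu hne => ?_⟩
      rw [r1 u hu, r1 a ((g1 a).2 ha)]
      exact hmax u ((g1 u).1 hu) hne
    exact ⟨by rw [hU a (Or.inl rfl)]; simp, fun j hj => hU j (Or.inr hj.symm)⟩

end Cycle

/-! ### Probability of a top vote. -/

section Votes

variable {V : Type*} [Fintype V]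

/-- Raising the largest vote below `R` by one makes it unique. -/
theorem pow_le_card_hasTopVote {R : ℕ} (E : V → Prop) (hE : ∃ a, E a) :
    R ^ Fintype.card V ≤ {d : V → Fin (R + 1) | HasTopVote E d}.ncard := by
  classical
  have hmax : ∀ f : V → Fin R, ∃ a, E a ∧ ∀ u, E u → f u ≤ f a := by
    intro f
    obtain ⟨a, ha, hm⟩ := (Finset.univ.filter E).exists_max_image f (by
      obtain ⟨a, ha⟩ := hE
      exact ⟨a, by simpa using ha⟩)
    exact ⟨a, by simpa using ha, fun u hu => hm u (by simpa using hu)⟩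
  choose top htop hle using hmax
  let raise : (V → Fin R) → V → Fin (R + 1) := fun f =>
    Function.update (fun u => (f u).castSucc) (top f) (f (top f)).succ
  have hlt : ∀ f u, E u → u ≠ top f → raise f u < raise f (top f) := by
    intro f u hu hne
    simp only [raise, Function.update_self, Function.update_of_ne hne]
    exact Fin.castSucc_lt_succ_iff.2 (hle f u hu)
  -- The raised node can be recovered as the strict maximum over `E`, and lowering it again gives
  -- back `f`.
  have hinj : Function.Injective raise := by
    intro f f' h
    have ht : top f = top f' := by
      by_contra hne
      have h1 := hlt f (top f') (htop f') (Ne.symm hne)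
      have h2 := hlt f' (top f) (htop f) hne
      rw [h] at h1
      exact lt_asymm h1 h2
    funext u
    have hu := congrFun h u
    by_cases hut : u = top f
    · rw [ht] at hut
      subst hut
      simpa [raise, ht] using hu
    · have hut' : u ≠ top f' := ht ▸ hut
      simpa [raise, hut, hut'] using hu
  calc R ^ Fintype.card V = (Set.range raise).ncard := by
        rw [← Set.image_univ, Set.ncard_image_of_injective _ hinj, Set.ncard_univ]
        simp
    _ ≤ _ := Set.ncard_le_ncard (by
        rintro _ ⟨f, rfl⟩
        exact ⟨top f, htop f, hlt f⟩) (Set.toFinite _)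

/-- Bernoulli's inequality: `(1 - 1/(R+1))^n ≥ 1 - n/(R+1) ≥ 1/2`. -/
theorem pow_le_two_mul_pow {n R : ℕ} (h : 2 * n ≤ R + 1) : (R + 1) ^ n ≤ 2 * R ^ n := by
  have h0 : (0 : ℝ) < R + 1 := by positivity
  have hn : (2 : ℝ) * n ≤ R + 1 := by exact_mod_cast h
  have hb := one_add_mul_sub_le_pow (a := (R : ℝ) / (R + 1)) (by
    have : (0 : ℝ) ≤ (R : ℝ) / (R + 1) := by positivity
    linarith) n
  have hq : (R : ℝ) / (R + 1) - 1 = -(1 / (R + 1)) := by field_simp; ring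
  have hhalf : (1 : ℝ) / 2 ≤ ((R : ℝ) / (R + 1)) ^ n := by
    refine le_trans ?_ hb
    rw [hq]
    have : (n : ℝ) * (1 / (R + 1)) ≤ 1 / 2 := by
      rw [mul_one_div, div_le_div_iff₀ h0 two_pos]
      linarith
    linarith
  rw [div_pow, le_div_iff₀ (by positivity)] at hhalf
  have : ((R : ℝ) + 1) ^ n ≤ 2 * (R : ℝ) ^ n := by linarith
  exact_mod_cast this

theorem one_le_two_mul_uniformOn_hasTopVote {R : ℕ} (hR : 2 * Fintype.card V ≤ R) (E : V → Prop)
    (hE : ∃ a, E a) :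
    1 ≤ 2 * uniformOn (Set.univ : Set (V → Fin R)) {d | HasTopVote E d} := by
  classical
  obtain ⟨a, -⟩ := id hE
  have hpos : 0 < Fintype.card V := Fintype.card_pos_iff.2 ⟨a⟩
  obtain ⟨R, rfl⟩ : ∃ R', R = R' + 1 := ⟨R - 1, by omega⟩
  rw [uniformOn_univ, Measure.count_apply_finite _ (Set.toFinite _),
    ← Set.ncard_eq_toFinset_card _ (Set.toFinite _), Fintype.card_fun, Fintype.card_fin,
    ← mul_div_assoc, ENNReal.le_div_iff_mul_le (by simp) (by simp), one_mul]
  exact_mod_cast (pow_le_two_mul_pow hR).trans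
    (Nat.mul_le_mul_left 2 (pow_le_card_hasTopVote E hE))

end Votes

/-! ### Bounds along a single trajectory. -/

section Trajectory

variable {V : Type*} {G : SimpleGraph V} {S : V → Type*} {R : ℕ}
  {A : R1W1Algorithm G S} {Λ : Set (∀ i, S i)} {T : ℕ}
  {d : ℕ → V → Fin R} {c : ℕ → MPConfig G S R}

/-- A cycle starts in `c`, and the simulated configuration is not legitimate. -/
def MPConfig.Pending (Λ : Set (∀ i, S i)) (c : MPConfig G S R) : Prop :=
  c.phase = .p1 ∧ c.x ∉ Λ

theorem phase_add_five_mul (h : ∀ t, TransformedStep A (d t) (c t) (c (t + 1))) {t : ℕ}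
    (hp : (c t).phase = .p1) (q : ℕ) : (c (t + 5 * q)).phase = .p1 := by
  induction q with
  | zero => exact hp
  | succ q ih =>
    show (c (t + 5 * q + 5)).phase = .p1
    simp only [(h _).phase_eq, ih, Phase.next]

theorem phase_add_ne (h : ∀ t, TransformedStep A (d t) (c t) (c (t + 1))) {t : ℕ}
    (hp : (c t).phase = .p1) {j : ℕ} (hj : 0 < j) (hj' : j < 5) : (c (t + j)).phase ≠ .p1 := by
  have e1 : (c (t + 1)).phase = .p2 := by rw [(h _).phase_eq, hp]; rfl
  have e2 : (c (t + 2)).phase = .p3 := by rw [(h (t + 1)).phase_eq, e1]; rfl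
  have e3 : (c (t + 3)).phase = .p4 := by rw [(h (t + 2)).phase_eq, e2]; rfl
  have e4 : (c (t + 4)).phase = .p5 := by rw [(h (t + 3)).phase_eq, e3]; rfl
  interval_cases j
  · simp [e1]
  · simp [e2]
  · simp [e3]
  · simp [e4]

theorem exists_phase_eq (h : ∀ t, TransformedStep A (d t) (c t) (c (t + 1))) :
    ∃ t ≤ 4, (c t).phase = .p1 ∧ ∀ s < t, (c s).phase ≠ .p1 := by
  classical
  have key : ∃ t ≤ 4, (c t).phase = .p1 := by
    have e1 := (h 0).phase_eq
    have e2 := (h 1).phase_eq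
    have e3 := (h 2).phase_eq
    have e4 := (h 3).phase_eq
    rcases hp : (c 0).phase with _ | _ | _ | _ | _
    · exact ⟨0, by omega, hp⟩
    · exact ⟨4, by omega, by simp [e4, e3, e2, e1, hp, Phase.next]⟩
    · exact ⟨3, by omega, by simp [e3, e2, e1, hp, Phase.next]⟩
    · exact ⟨2, by omega, by simp [e2, e1, hp, Phase.next]⟩
    · exact ⟨1, by omega, by simp [e1, hp, Phase.next]⟩
  obtain ⟨t, ht, hp⟩ := key
  have hex : ∃ t, (c t).phase = .p1 := ⟨t, hp⟩
  exact ⟨Nat.find hex, (Nat.find_le hp).trans ht, Nat.find_spec hex, fun s => Nat.find_min hex⟩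

variable [Fintype V]

theorem convergedAt_of_mem (hA : A.StabilizesWithin Λ T)
    (h : ∀ t, TransformedStep A (d t) (c t) (c (t + 1))) {t : ℕ} (hp : (c t).phase = .p1)
    (hc : (c t).Coherent) (hx : (c t).x ∈ Λ) : ConvergedAt Λ c t := by
  refine ⟨hp, fun s hs hps => ?_⟩
  have key : ∀ q, (c (t + 5 * q)).Coherent ∧ (c (t + 5 * q)).x ∈ Λ := by
    intro q
    induction q with
    | zero => exact ⟨hc, hx⟩
    | succ q ih =>
      obtain ⟨hc', m, hm, -⟩ := TransformedStep.cycle h (phase_add_five_mul h hp q)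
      exact ⟨hc', hA.mem_of_movesIn hm ih.2⟩
  have hdiv : s = t + 5 * ((s - t) / 5) + (s - t) % 5 := by omega
  rcases Nat.eq_zero_or_pos ((s - t) % 5) with h0 | h0
  · rw [h0, add_zero] at hdiv
    rw [hdiv]
    exact key _
  · rw [hdiv] at hps
    exact absurd hps (phase_add_ne h (phase_add_five_mul h hp _) h0 (Nat.mod_lt _ (by norm_num)))

open scoped Classical in
/-- The number of cycles that start outside of the legitimate set bounds the convergence time. -/
theorem convergenceTime_le (hA : A.StabilizesWithin Λ T)
    (h : ∀ t, TransformedStep A (d t) (c t) (c (t + 1))) :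
    (convergenceTime Λ c : ℝ≥0∞) ≤ 9 + 5 * ∑' t, if (c t).Pending Λ then 1 else 0 := by
  obtain ⟨t, ht, hp, -⟩ := exists_phase_eq h
  have hq := phase_add_five_mul h hp
  -- The shift `q + 1` skips the first full cycle, which is spent on coherence. With at most four
  -- rounds before that cycle, this gives the constant 9.
  have hinj : Function.Injective fun q => t + 5 * (q + 1) := by
    intro a b hab
    have : t + 5 * (a + 1) = t + 5 * (b + 1) := hab
    omega
  have hle := ENNReal.tsum_comp_le_tsum_of_injective hinj
    (fun t => if (c t).Pending Λ then (1 : ℝ≥0∞) else 0)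
  by_cases hex : ∃ q, (c (t + 5 * (q + 1))).x ∈ Λ
  · have hmin : ∀ j < Nat.find hex, (c (t + 5 * (j + 1))).Pending Λ := fun j hj =>
      ⟨hq _, Nat.find_min hex hj⟩
    have hcoh := (TransformedStep.cycle h (hq (Nat.find hex))).1
    have hconv := convergedAt_of_mem hA h (hq (Nat.find hex + 1)) hcoh (Nat.find_spec hex)
    generalize Nat.find hex = q at *
    have h1 : (convergenceTime Λ c : ℝ≥0∞) ≤ ((t + 5 * (q + 1) : ℕ) : ℝ≥0∞) := by
      rw [← ENat.toENNReal_coe, ENat.toENNReal_le]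
      exact iInf₂_le _ hconv
    have h2 : (q : ℝ≥0∞) ≤ ∑' t, if (c t).Pending Λ then 1 else 0 := by
      refine le_trans ?_ ((ENNReal.sum_le_tsum (Finset.range q)).trans hle)
      rw [Finset.sum_congr rfl fun j hj => if_pos (hmin j (Finset.mem_range.1 hj))]
      simp
    calc (convergenceTime Λ c : ℝ≥0∞) ≤ ((t + 5 * (q + 1) : ℕ) : ℝ≥0∞) := h1
      _ ≤ ((9 + 5 * q : ℕ) : ℝ≥0∞) := by
        norm_cast
        omega
      _ ≤ _ := by
        push_cast
        gcongr
  · push Not at hex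
    have htop : ∑' t, (if (c t).Pending Λ then 1 else 0 : ℝ≥0∞) = ⊤ := by
      refine top_unique (le_trans ?_ hle)
      rw [tsum_congr fun j => if_pos ⟨hq _, hex j⟩]
      simp
    rw [htop]
    simp

open scoped Classical in
/-- Outside of the legitimate set, at most `T` cycles have a node with the top vote. -/
theorem tsum_hasTopVote_le (hA : A.StabilizesWithin Λ T)
    (h : ∀ t, TransformedStep A (d t) (c t) (c (t + 1))) :
    ∑' t, (if (c t).Pending Λ ∧ HasTopVote (fun i => A.Enabled i (fun j => (c t).x j)) (d t)
      then 1 else 0 : ℝ≥0∞) ≤ T := by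
  set P : ℕ → Prop := fun t =>
    (c t).Pending Λ ∧ HasTopVote (fun i => A.Enabled i (fun j => (c t).x j)) (d t) with hP
  obtain ⟨t, -, hp, hlt⟩ := exists_phase_eq h
  have hq := phase_add_five_mul h hp
  let a : ℕ → ℕ := fun s => if P s then 1 else 0
  have ha : ∀ s, (c s).phase ≠ .p1 → a s = 0 := fun s hs => if_neg fun hs' => hs hs'.1.1
  -- The count is also bounded by the number `m` of simulated moves. A pending cycle start forces `m
  -- < T`, which leaves room to count one more.
  have key : ∀ q, ∑ s ∈ Finset.range (t + 5 * q), a s ≤ T ∧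
      ∃ m, A.MovesIn m (c t).x (c (t + 5 * q)).x ∧ ∑ s ∈ Finset.range (t + 5 * q), a s ≤ m := by
    intro q
    induction q with
    | zero =>
      have h0 : ∑ s ∈ Finset.range (t + 5 * 0), a s = 0 :=
        Finset.sum_eq_zero fun s hs => ha s (hlt s (by simpa using hs))
      rw [h0]
      exact ⟨Nat.zero_le _, 0, rfl, le_rfl⟩
    | succ q ih =>
      obtain ⟨h1, m, hm, hmle⟩ := ih
      obtain ⟨-, k, hk, hk1⟩ := TransformedStep.cycle h (hq q)
      have hsum : ∑ s ∈ Finset.range (t + 5 * (q + 1)), a s =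
          ∑ s ∈ Finset.range (t + 5 * q), a s + a (t + 5 * q) := by
        have hne := fun j h0 h5 => ha _ (phase_add_ne h (hq q) (j := j) h0 h5)
        have e1 : a (t + 5 * q + 1) = 0 := hne 1 (by omega) (by omega)
        have e2 : a (t + 5 * q + 1 + 1) = 0 := hne 2 (by omega) (by omega)
        have e3 : a (t + 5 * q + 1 + 1 + 1) = 0 := hne 3 (by omega) (by omega)
        have e4 : a (t + 5 * q + 1 + 1 + 1 + 1) = 0 := hne 4 (by omega) (by omega)
        show ∑ s ∈ Finset.range (t + 5 * q + 1 + 1 + 1 + 1 + 1), a s = _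
        simp only [Finset.sum_range_succ, e1, e2, e3, e4, add_zero]
      rw [hsum]
      refine ⟨?_, m + k, hm.trans hk, ?_⟩
      · by_cases hPq : P (t + 5 * q)
        · have hmT : m < T := lt_of_not_ge fun hT => hPq.1.2 (hA.mem_of_le hm hT)
          have haq : a (t + 5 * q) = 1 := if_pos hPq
          omega
        · have haq : a (t + 5 * q) = 0 := if_neg hPq
          omega
      · by_cases hPq : P (t + 5 * q)
        · have := hk1 hPq.2
          have haq : a (t + 5 * q) = 1 := if_pos hPq
          omega
        · have haq : a (t + 5 * q) = 0 := if_neg hPq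
          omega
  refine ENNReal.tsum_le_of_sum_range_le fun n => ?_
  have hn : ∑ s ∈ Finset.range n, a s ≤ T :=
    (Finset.sum_le_sum_of_subset (Finset.range_mono (by omega))).trans (key n).1
  calc ∑ s ∈ Finset.range n, (if P s then 1 else 0 : ℝ≥0∞)
      = ((∑ s ∈ Finset.range n, a s : ℕ) : ℝ≥0∞) := by
        push_cast [a]
        rfl
    _ ≤ T := by exact_mod_cast hn

theorem MPConfig.bcasts_le_card (c : MPConfig G S R) : c.bcasts ≤ Fintype.card V := by
  classical
  unfold MPConfig.bcasts
  split
  · exact le_rfl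
  all_goals exact Fintype.card_subtype_le _

theorem bcastsBeforeConvergence_le (Λ : Set (∀ i, S i)) (c : ℕ → MPConfig G S R) :
    bcastsBeforeConvergence Λ c ≤ Fintype.card V * (convergenceTime Λ c : ℝ≥0∞) := by
  classical
  have hcount : ∀ L : ℕ∞, ∑' t : ℕ, (if (t : ℕ∞) < L then 1 else 0 : ℝ≥0∞) ≤ L := by
    intro L
    refine ENNReal.tsum_le_of_sum_range_le fun n => ?_
    rw [Finset.sum_boole, ← ENat.toENNReal_coe, ENat.toENNReal_le]
    induction L with
    | top => exact le_top
    | coe m =>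
      have hsub : (Finset.range n).filter (fun t : ℕ => (t : ℕ∞) < m) ⊆ Finset.range m := by
        intro t ht
        have := (Finset.mem_filter.1 ht).2
        exact Finset.mem_range.2 (by exact_mod_cast this)
      exact_mod_cast (Finset.card_le_card hsub).trans_eq (Finset.card_range m)
  calc bcastsBeforeConvergence Λ c
      ≤ ∑' t : ℕ, (Fintype.card V : ℝ≥0∞) * if (t : ℕ∞) < convergenceTime Λ c then 1 else 0 := by
        refine ENNReal.tsum_le_tsum fun t => ?_
        split_ifs
        · rw [mul_one]
          exact_mod_cast (c t).bcasts_le_card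
        · simp
    _ ≤ _ := by
        rw [ENNReal.tsum_mul_left]
        gcongr
        exact hcount _

end Trajectory

/-! ### Passage to expectations. -/

section Expectation

variable {V : Type*} {G : SimpleGraph V} {S : V → Type*} {R : ℕ}
  {A : R1W1Algorithm G S} {Λ : Set (∀ i, S i)} {T : ℕ} {Ω : Type*} [mΩ : MeasurableSpace Ω]
  {μ : Measure Ω} {ℱ : Filtration ℕ mΩ} {d : ℕ → Ω → V → Fin R} {X : ℕ → Ω → MPConfig G S R}

namespace IsTransformedExecution

theorem measurableSet (hX : IsTransformedExecution A μ ℱ d X) (t : ℕ)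
    (p : MPConfig G S R → Prop) : MeasurableSet[ℱ t] {ω | p (X t ω)} :=
  hX.adapted t {c | p c}

variable [Fintype V]

theorem measure_hasTopVote (hX : IsTransformedExecution A μ ℱ d X) (t : ℕ)
    (p : MPConfig G S R → Prop) (E : V → Prop) :
    μ {ω | p (X t ω) ∧ HasTopVote E (d t ω)} =
      μ {ω | p (X t ω)} * uniformOn Set.univ {v : V → Fin R | HasTopVote E v} := by
  have hE : MeasurableSet {v : V → Fin R | HasTopVote E v} := MeasurableSet.of_discrete
  rw [← hX.uniform_draw t, Measure.map_apply (hX.measurable_draw t) hE]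
  exact (Indep_iff _ _ _).1 (hX.indep_draw t) _ _ (hX.measurableSet t p) ⟨_, hE, rfl⟩

theorem measurableSet_pending_hasTopVote (hX : IsTransformedExecution A μ ℱ d X)
    (Λ : Set (∀ i, S i)) (t : ℕ) :
    MeasurableSet {ω | (X t ω).Pending Λ ∧
      HasTopVote (fun i => A.Enabled i (fun j => (X t ω).x j)) (d t ω)} := by
  classical
  let enabled : MPConfig G S R → V → Prop := fun c i => A.Enabled i (fun j => c.x j)
  have : {ω | (X t ω).Pending Λ ∧ HasTopVote (enabled (X t ω)) (d t ω)} =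
      ⋃ v : V → Fin R, {ω | (X t ω).Pending Λ ∧ HasTopVote (enabled (X t ω)) v} ∩
        d t ⁻¹' {v} := by
    ext ω
    simp
  exact this ▸ MeasurableSet.iUnion fun v =>
    (ℱ.le t _ (hX.measurableSet t fun c => c.Pending Λ ∧ HasTopVote (enabled c) v)).inter
      (hX.measurable_draw t (measurableSet_singleton v))

/-- The set of enabled nodes is random but known before the draw. Splitting over its finitely many
values `E` lets independence apply for each fixed `E`; outside `Λ`, `E` is nonempty. -/
theorem measure_pending_le (hX : IsTransformedExecution A μ ℱ d X)
    (hA : A.StabilizesWithin Λ T) (hR : 2 * Fintype.card V ≤ R) (t : ℕ) :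
    μ {ω | (X t ω).Pending Λ} ≤ 2 * μ {ω | (X t ω).Pending Λ ∧
      HasTopVote (fun i => A.Enabled i (fun j => (X t ω).x j)) (d t ω)} := by
  classical
  let enabled : MPConfig G S R → V → Prop := fun c i => A.Enabled i (fun j => c.x j)
  have hsplit : ∀ s : Set Ω, MeasurableSet s →
      μ s = ∑ E : V → Prop, μ (s ∩ {ω | enabled (X t ω) = E}) := by
    intro s hs
    have hm : ∀ E : V → Prop, MeasurableSet {ω | enabled (X t ω) = E} := fun E =>
      ℱ.le t _ (hX.measurableSet t fun c => enabled c = E)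
    rw [← measure_biUnion_finset]
    · congr 1
      ext ω
      simp
    · intro E _ E' _ hne
      refine Set.disjoint_left.2 fun ω h1 h2 => hne ?_
      exact h1.2.symm.trans h2.2
    · exact fun E _ => hs.inter (hm E)
  have hB : MeasurableSet {ω | (X t ω).Pending Λ} := ℱ.le t _ (hX.measurableSet t _)
  have hA' := hX.measurableSet_pending_hasTopVote Λ t
  rw [hsplit _ hB, hsplit _ hA', Finset.mul_sum]
  refine Finset.sum_le_sum fun E _ => ?_
  by_cases hE : ∃ a, E a
  · have h1 : {ω | (X t ω).Pending Λ ∧ HasTopVote (enabled (X t ω)) (d t ω)} ∩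
        {ω | enabled (X t ω) = E} =
        {ω | ((X t ω).Pending Λ ∧ enabled (X t ω) = E) ∧ HasTopVote E (d t ω)} := by
      ext ω
      constructor
      · rintro ⟨⟨h1, h2⟩, rfl⟩
        exact ⟨⟨h1, rfl⟩, h2⟩
      · rintro ⟨⟨h1, rfl⟩, h2⟩
        exact ⟨⟨h1, h2⟩, rfl⟩
    rw [h1, hX.measure_hasTopVote t (fun c => c.Pending Λ ∧ enabled c = E) E, mul_left_comm]
    exact le_mul_of_one_le_right' (one_le_two_mul_uniformOn_hasTopVote hR E hE)
  · have h0 : {ω | (X t ω).Pending Λ} ∩ {ω | enabled (X t ω) = E} = ∅ := by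
      refine Set.eq_empty_of_forall_notMem ?_
      rintro ω ⟨h1, rfl⟩
      exact hE (hA.exists_enabled h1.2)
    rw [h0, measure_empty]
    exact zero_le

open scoped Classical in
theorem lintegral_pending_le [IsProbabilityMeasure μ] (hX : IsTransformedExecution A μ ℱ d X)
    (hA : A.StabilizesWithin Λ T) (hR : 2 * Fintype.card V ≤ R) :
    ∫⁻ ω, ∑' t, (if (X t ω).Pending Λ then 1 else 0 : ℝ≥0∞) ∂μ ≤ 2 * T := by
  have hB : ∀ t, MeasurableSet {ω | (X t ω).Pending Λ} := fun t =>
    ℱ.le t _ (hX.measurableSet t _)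
  have hcount : ∀ p : ℕ → Ω → Prop, (∀ t, MeasurableSet {ω | p t ω}) →
      ∫⁻ ω, ∑' t, (if p t ω then 1 else 0 : ℝ≥0∞) ∂μ = ∑' t, μ {ω | p t ω} := by
    intro p hp
    rw [lintegral_tsum fun t =>
      (Measurable.ite (hp t) measurable_const measurable_const).aemeasurable]
    congr 1
    funext t
    rw [← lintegral_indicator_one (hp t)]
    rfl
  rw [hcount _ hB]
  calc ∑' t, μ {ω | (X t ω).Pending Λ}
      ≤ 2 * ∑' t, μ {ω | (X t ω).Pending Λ ∧
          HasTopVote (fun i => A.Enabled i (fun j => (X t ω).x j)) (d t ω)} := by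
        rw [← ENNReal.tsum_mul_left]
        exact ENNReal.tsum_le_tsum (hX.measure_pending_le hA hR)
    _ ≤ 2 * ∫⁻ _, T ∂μ := by
        -- The sum of probabilities becomes the expectation of a count that never exceeds `T`.
        rw [← hcount _ (hX.measurableSet_pending_hasTopVote Λ)]
        gcongr with ω
        convert tsum_hasTopVote_le hA fun t => hX.step t ω
    _ = 2 * T := by simp

theorem lintegral_convergenceTime_le [IsProbabilityMeasure μ]
    (hX : IsTransformedExecution A μ ℱ d X) (hA : A.StabilizesWithin Λ T)
    (hR : 2 * Fintype.card V ≤ R) :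
    ∫⁻ ω, (convergenceTime Λ (fun t => X t ω) : ℝ≥0∞) ∂μ ≤ 9 + 10 * T := by
  classical
  calc ∫⁻ ω, (convergenceTime Λ (fun t => X t ω) : ℝ≥0∞) ∂μ
      ≤ ∫⁻ ω, 9 + 5 * ∑' t, (if (X t ω).Pending Λ then 1 else 0 : ℝ≥0∞) ∂μ :=
        lintegral_mono fun ω => convergenceTime_le hA fun t => hX.step t ω
    _ = 9 + 5 * ∫⁻ ω, ∑' t, (if (X t ω).Pending Λ then 1 else 0 : ℝ≥0∞) ∂μ := by
        rw [lintegral_add_left measurable_const, lintegral_const_mul' _ _ (by simp)]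
        simp
    _ ≤ 9 + 5 * (2 * T) := by
        gcongr
        exact hX.lintegral_pending_le hA hR
    _ = 9 + 10 * T := by rw [← mul_assoc]; norm_num

end IsTransformedExecution

end Expectation

/-! ### The main theorem. -/

theorem mainTheorem5 :
    ∃ C : ℕ, ∀ (V : Type*) [Fintype V] (G : SimpleGraph V) (S : V → Type*)
      (A : R1W1Algorithm G S) (Λ : Set (∀ i, S i)) (T : ℕ),
      1 ≤ T → A.StabilizesWithin Λ T →
      ∀ (K n' : ℕ), 2 ≤ K → Fintype.card V ≤ n' →
      ∀ (Ω : Type*) [mΩ : MeasurableSpace Ω] (μ : Measure Ω) [IsProbabilityMeasure μ]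
        (ℱ : Filtration ℕ mΩ) (d : ℕ → Ω → V → Fin (K * n'))
        (X : ℕ → Ω → MPConfig G S (K * n')),
        IsTransformedExecution A μ ℱ d X →
        ((∫⁻ ω, bcastsBeforeConvergence Λ (fun t => X t ω) ∂μ) ≤ C * Fintype.card V * T) ∧
        ((∫⁻ ω, (convergenceTime Λ (fun t => X t ω) : ℝ≥0∞) ∂μ) ≤ C * T) := by
  -- The constant 19 absorbs `9 + 10 * T`, as `T ≥ 1`.
  refine ⟨19, fun V _ G S A Λ T hT hA K n' hK hn Ω _ μ _ ℱ d X hX => ?_⟩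
  have htime : ∫⁻ ω, (convergenceTime Λ (fun t => X t ω) : ℝ≥0∞) ∂μ ≤ 19 * T := by
    refine (hX.lintegral_convergenceTime_le hA (Nat.mul_le_mul hK hn)).trans ?_
    norm_cast
    omega
  refine ⟨?_, by exact_mod_cast htime⟩
  calc ∫⁻ ω, bcastsBeforeConvergence Λ (fun t => X t ω) ∂μ
      ≤ ∫⁻ ω, Fintype.card V * (convergenceTime Λ (fun t => X t ω) : ℝ≥0∞) ∂μ :=
        lintegral_mono fun ω => bcastsBeforeConvergence_le Λ fun t => X t ω
    _ ≤ Fintype.card V * (19 * T) := by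
        rw [lintegral_const_mul' _ _ (ENNReal.natCast_ne_top _)]
        gcongr
    _ = (19 : ℕ) * Fintype.card V * T := by
        push_cast
        ring
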